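/- **Definitions.** A *vocabulary* $\tau$ is a finite set of function symbols $F$ with arities $\mathrm{arity}(F)\ge 1$, containing a unary symbol $\mathrm{id}$; $\mathrm{arity}(\tau)=\max_{F}\mathrm{arity}(F)$. A *full index model* ($\tau$-fim) $M$ is a finite set $M$ with a non-empty subset $P^M$, a linear order of $P^M$, and for every $F\in\tau$ a symmetric function $F^M:(P^M)^{\mathrm{arity}(F)}\to M$, such that: $F^M(\bar a)=G^M(\bar b)$ with $\bar a,\bar b$ non-decreasing implies $F=G$ and $\bar a=\bar b$; every element of $M\setminus P^M$ is a value of some $F^M$; and $\mathrm{id}^M$ is the identity of $P^M$. Thus each $b\in M$ is $F^M(a_1,\dots,a_r)$ for a unique $F=F_{M,b}$ and a unique multiset of arguments; $\mathrm{base}(b)=\{a_1,\dots,a_r\}$. The dimension of $M$ is $|P^M|\ge 1$. A set $B\subseteq M$ is *closed* if $F^M(\bar a)\in B$ iff all $a_i\in B$; $\mathrm{cl}_M(A)$ is the least closed set including $A$. A *$\tau$-alphabet sequence* $\bar\Lambda=\langle\Lambda_F:F\in\tau\rangle$ consists of finite non-empty sets. $\mathrm{Space}_{\bar\Lambda}(M)$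 is the set of functions $\eta$ on $M$ with $\eta(b)\in\Lambda_{F_{M,b}}$. A *line* is a set $L\subseteq \mathrm{Space}_{\bar\Lambda}(M)$ for which there is $S\subseteq M$ such that $S\cap P^M\neq\emptyset$, $S=\mathrm{cl}_M(S\cap P^M)$, any two members of $L$ agree off $S$, for every $\eta\in L$ there is $p\in\prod_F\Lambda_F$ with $\eta(b)=p(F_{M,b})$ for all $b\in S$, and every $p\in\prod_F\Lambda_F$ occurs in this way. A $c$-colouring is a map into a set of $c$ colours; a line is monochromatic if the colouring is constant on it. $f^1_\tau(\bar\Lambda,c)$ is the least $k\ge1$ such that for every $\tau$-fim $M$ of dimension $k$, every $c$-colouring of $\mathrm{Space}_{\bar\Lambda}(M)$ has a monochromatic line ($\infty$ if there is none). Let $\tau$ be *monic*, i.e. it has a unique symbol $H$ of maximal arity. For a closed $N\subseteq M$ and $\alpha\in\Lambda_H$, a colouring $d$ is *$(N,\alpha,H)$-invariant* if for every $a\in P^M\cap N$ and all $\nu,\eta$ in the space that agree on $\mathrm{cl}_M(P^M\setminus\{a\})$ and satisfy $\nu(b)=\alpha=\eta(b)$ for the element $b=H^M(a,\dots,a)$,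 we have $d(\nu)=d(\eta)$. For $n<|\Lambda_H|$, or $n=|\Lambda_H|$ and $\ell=0$, let $f^0_{\tau,\bar\Lambda}(n,\ell,c)$ be the least $k\ge 1$ such that for every $\tau$-fim $M$ of dimension $k$, every $\Lambda^\circ\subseteq\Lambda_H$ with exactly $n$ elements, and every $c$-colouring $d$ of $\mathrm{Space}_{\bar\Lambda}(M)$ that is $(M,\alpha,H)$-invariant for all $\alpha\in\Lambda^\circ$ and, if $\ell\ne0$, is $(N,\alpha,H)$-invariant for some $\alpha\in\Lambda_H\setminus\Lambda^\circ$, where $N$ is the closure of the set of the last $\ell$ elements of $P^M$ (of all of $P^M$ if $|P^M|<\ell$), there is a $d$-monochromatic line ($\infty$ if there is none). A function on tuples of natural numbers is *triply recursive* if it is obtained by substituting primitive recursive functions for the arguments of a function $F(x,y,z,p_1,\dots,p_m)$ that is defined by one nested recursion over the lexicographic order of the triples $(x,y,z)$: $F(x,y,z,\bar p)$ is given by a term built from $x,y,z,\bar p$, primitive recursive functions and (possibly nested) values of $F$ at lexicographically smaller triples with arbitrary parameters (a call at a triple that is not smaller is read as $0$). **Theorem.** (1) For every vocabulary $\tau$,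 $\tau$-alphabet sequence $\bar\Lambda$ and $c\in\mathbb N$, the value $f^1_\tau(\bar\Lambda,c)$ is a natural number; and for every $\tau$-fim $M$ of dimension at least $f^1_\tau(\bar\Lambda,c)$, every $c$-colouring of $\mathrm{Space}_{\bar\Lambda}(M)$ has a monochromatic line. Moreover there is a triply recursive function $B$ such that always $$f^1_\tau(\bar\Lambda,c)\le B\bigl(\mathrm{arity}(\tau),\,|\tau|,\,\max_{F\in\tau}|\Lambda_F|,\,c\bigr).$$ (2) Similarly, for every monic $\tau$ with maximal symbol $H$, every $\tau$-alphabet sequence $\bar\Lambda$, and all $c,n,\ell$ with $n<|\Lambda_H|$ or ($n=|\Lambda_H|$ and $\ell=0$), the value $f^0_{\tau,\bar\Lambda}(n,\ell,c)$ is a natural number, and there is a triply recursive function $B_0$ such that always $$f^0_{\tau,\bar\Lambda}(n,\ell,c)\le B_0\bigl(\mathrm{arity}(\tau),\,|\tau|,\,\max_{F\in\tau}|\Lambda_F|,\,n,\,\ell,\,c\bigr).$$ -/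

import Mathlib

universe u

/-- A vocabulary: finitely many function symbols of positive arity, one of which is the distinguished
unary symbol `id`. (The predicates `P` and `<` belong to every vocabulary and are not listed.) -/
structure Vocabulary where
  Sym : Type u
  [fintypeSym : Fintype Sym]
  symArity : Sym → ℕ
  symArity_pos : ∀ F, 0 < symArity F
  ident : Sym
  symArity_ident : symArity ident = 1

namespace Vocabulary

instance (τ : Vocabulary.{u}) : Fintype τ.Sym := τ.fintypeSym

/-- The arity of a vocabulary: the maximal arity of its function symbols. -/
def arity (τ : Vocabulary.{u}) : ℕ := Finset.univ.sup τ.symArity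

/-- The number of function symbols. -/
def size (τ : Vocabulary.{u}) : ℕ := Fintype.card τ.Sym

/-- `H` is the unique function symbol of maximal arity (so the vocabulary is monic). -/
def IsMaxSym (τ : Vocabulary.{u}) (H : τ.Sym) : Prop :=
  ∀ F, F ≠ H → τ.symArity F < τ.symArity H

end Vocabulary

/-- A full index model for `τ`. The function `fn F` interprets the symbol `F`; it is defined exactly on
the tuples from `P`. -/
structure Fim (τ : Vocabulary.{u}) where
  Carrier : Type u
  finite_carrier : Finite Carrier
  P : Set Carrier
  P_nonempty : P.Nonempty
  order : LinearOrder P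
  fn : (F : τ.Sym) → (Fin (τ.symArity F) → P) → Carrier
  fn_symm : ∀ (F : τ.Sym) (σ : Equiv.Perm (Fin (τ.symArity F))) (a : Fin (τ.symArity F) → P),
    fn F (a ∘ σ) = fn F a
  fn_inj : ∀ (F G : τ.Sym) (a : Fin (τ.symArity F) → P) (b : Fin (τ.symArity G) → P),
    Monotone a → Monotone b → fn F a = fn G b →
      (⟨F, a⟩ : Σ F : τ.Sym, (Fin (τ.symArity F) → P)) = ⟨G, b⟩
  fn_surj : ∀ b, b ∉ P → ∃ (F : τ.Sym) (a : Fin (τ.symArity F) → P), fn F a = b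
  fn_ident : ∀ (a : Fin (τ.symArity τ.ident) → P) (i : Fin (τ.symArity τ.ident)),
    fn τ.ident a = a i

namespace Fim

variable {τ : Vocabulary.{u}} (M : Fim τ)

instance : LinearOrder M.P := M.order

/-- The dimension: the number of elements of `P`. -/
noncomputable def dim : ℕ := Nat.card M.P

theorem exists_fn (b : M.Carrier) :
    ∃ (F : τ.Sym) (a : Fin (τ.symArity F) → M.P), M.fn F a = b := by
  by_cases h : b ∈ M.P
  · refine ⟨τ.ident, fun _ => ⟨b, h⟩, ?_⟩
    exact M.fn_ident _ ⟨0, τ.symArity_pos _⟩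
  · exact M.fn_surj b h

/-- The function symbol `F` such that `b` is a value of `F`. -/
noncomputable def sym (b : M.Carrier) : τ.Sym := (M.exists_fn b).choose

theorem sym_fn (F : τ.Sym) (a : Fin (τ.symArity F) → M.P) : M.sym (M.fn F a) = F := by
  obtain ⟨a', ha'⟩ := (M.exists_fn (M.fn F a)).choose_spec
  have h := M.fn_inj _ _ (a' ∘ Tuple.sort a') (a ∘ Tuple.sort a)
    (Tuple.monotone_sort a') (Tuple.monotone_sort a)
    (by rw [M.fn_symm, M.fn_symm]; exact ha')
  exact congrArg Sigma.fst h

/-- The set of those elements of `P` that occur as arguments in a presentation `b = F(a₁, …, aᵣ)`. -/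
def base (b : M.Carrier) : Set M.P :=
  {x | ∃ (F : τ.Sym) (a : Fin (τ.symArity F) → M.P), M.fn F a = b ∧ ∃ i, a i = x}

/-- Closed subsets: `F(a₁, …, aᵣ)` lies in `B` iff all of `a₁, …, aᵣ` do. -/
def IsClosedSet (B : Set M.Carrier) : Prop :=
  ∀ (F : τ.Sym) (a : Fin (τ.symArity F) → M.P), M.fn F a ∈ B ↔ ∀ i, (a i : M.Carrier) ∈ B

/-- The smallest closed set that includes `A`. -/
def cl (A : Set M.Carrier) : Set M.Carrier := ⋂₀ {B | M.IsClosedSet B ∧ A ⊆ B}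

/-- The last `ℓ` elements of `P` (all of `P` when it has at most `ℓ` elements). -/
def lastElements (ℓ : ℕ) : Set M.Carrier :=
  Subtype.val '' {a : M.P | (Set.Ioi a).ncard < ℓ}

/-- The space over `M`: all functions `η` on `M` with `η b ∈ Λ F` when `b` is a value of `F`. -/
def Space (Λ : τ.Sym → Type u) (M : Fim τ) : Type u := (b : M.Carrier) → Λ (M.sym b)

variable {M} {Λ : τ.Sym → Type u}

/-- `L` is a `q`-line of the space, `q` being a set of types `p ∈ ∏ F, Λ F`; `S` is its support. -/
def IsLine (q : Set ((F : τ.Sym) → Λ F)) (L : Set (Space Λ M)) : Prop :=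
  ∃ S : Set M.Carrier,
    (S ∩ M.P).Nonempty ∧
    S = M.cl (S ∩ M.P) ∧
    (∀ η ∈ L, ∀ ν ∈ L, ∀ b, b ∉ S → η b = ν b) ∧
    (∀ η ∈ L, ∃ p ∈ q, ∀ b ∈ S, η b = p (M.sym b)) ∧
    (∀ p ∈ q, ∃ η ∈ L, ∀ b ∈ S, η b = p (M.sym b))

/-- The colouring `d` has a monochromatic line (a line for the set of all types). -/
def HasMonoLine {C : Type*} (d : Space Λ M → C) : Prop :=
  ∃ L : Set (Space Λ M), IsLine Set.univ L ∧ ∀ η ∈ L, ∀ ν ∈ L, d η = d ν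

/-- `d` is `(N, α, H)`-invariant, for a closed set `N` of `M`: for `a ∈ P ∩ N`, if `η` and `ν` agree on
the closure of `P \ {a}` and both take the value `α` at `H(a, …, a)`, then they have the same
colour. -/
def Invariant {C : Type*} (d : Space Λ M → C) (N : Set M.Carrier) (H : τ.Sym) (α : Λ H) : Prop :=
  ∀ a : M.P, (a : M.Carrier) ∈ N → ∀ ν η : Space Λ M,
    (∀ b ∈ M.cl (M.P \ {(a : M.Carrier)}), ν b = η b) →
    (∀ b, M.base b = {a} → ∀ hb : M.sym b = H, ν b = hb ▸ α ∧ η b = hb ▸ α) →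
    d ν = d η

end Fim

section Functions

variable {τ : Vocabulary.{u}} (Λ : τ.Sym → Type u)

/-- The largest size of an alphabet. -/
noncomputable def alphabetMax : ℕ := Finset.univ.sup fun F => Nat.card (Λ F)

/-- Every `c`-colouring of the space over a `k`-dimensional model has a monochromatic line. -/
def F1Holds (c k : ℕ) : Prop :=
  ∀ M : Fim τ, M.dim = k → ∀ d : Fim.Space Λ M → Fin c, Fim.HasMonoLine d

/-- The function `f¹`: the least possible dimension `k` (dimensions are positive) as in `F1Holds`,
and `⊤` if there is none. -/
noncomputable def f1 (c : ℕ) : ℕ∞ := sInf {x | ∃ k : ℕ, 1 ≤ k ∧ F1Holds Λ c k ∧ x = k}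

/-- The condition that defines `f⁰`; it is used for the symbol `H` of maximal arity. -/
def F0Holds (H : τ.Sym) (n ℓ c k : ℕ) : Prop :=
  ∀ M : Fim τ, M.dim = k → ∀ d : Fim.Space Λ M → Fin c, ∀ Λ₀ : Set (Λ H), Λ₀.ncard = n →
    (∀ α ∈ Λ₀, Fim.Invariant d Set.univ H α) →
    (ℓ ≠ 0 → ∃ α, α ∉ Λ₀ ∧ Fim.Invariant d (M.cl (M.lastElements ℓ)) H α) →
    Fim.HasMonoLine d

/-- The function `f⁰`, as an extended natural number. -/
noncomputable def f0 (H : τ.Sym) (n ℓ c : ℕ) : ℕ∞ :=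
  sInf {x | ∃ k : ℕ, 1 ≤ k ∧ F0Holds Λ H n ℓ c k ∧ x = k}

end Functions

/-- Right-hand sides of a definition of `F(x, y, z, p₁, …, pₘ)` by nested recursion: terms built from
the arguments, primitive recursive functions and calls of `F`. -/
inductive RecTerm (m : ℕ) : Type
  | x : RecTerm m
  | y : RecTerm m
  | z : RecTerm m
  | param (i : Fin m) : RecTerm m
  | prim {r : ℕ} (g : (Fin r → ℕ) → ℕ) (hg : Primrec g) (ts : Fin r → RecTerm m) : RecTerm m
  | call (t₁ t₂ t₃ : RecTerm m) (ts : Fin m → RecTerm m) : RecTerm m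

/-- The value of a term at `(x, y, z, p)`. Only calls of `F` at a triple that is lexicographically
below `(x, y, z)` are answered, other calls return `0`. -/
def RecTerm.eval {m : ℕ} (F : ℕ → ℕ → ℕ → (Fin m → ℕ) → ℕ) (x y z : ℕ) (p : Fin m → ℕ) :
    RecTerm m → ℕ
  | .x => x
  | .y => y
  | .z => z
  | .param i => p i
  | .prim g _ ts => g fun i => (ts i).eval F x y z p
  | .call t₁ t₂ t₃ ts =>
    let x' := t₁.eval F x y z p
    let y' := t₂.eval F x y z p
    let z' := t₃.eval F x y z p
    if x' < x ∨ (x' = x ∧ (y' < y ∨ (y' = y ∧ z' < z))) then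
      F x' y' z' fun i => (ts i).eval F x y z p
    else 0

/-- Functions defined from primitive recursive functions by a triple (nested) recursion: `F` is the
unique solution of the recursion equation with right-hand side `T`, and `f` is obtained from `F` by
substituting primitive recursive functions for its arguments. -/
def TripleRecursive {k : ℕ} (f : (Fin k → ℕ) → ℕ) : Prop :=
  ∃ (m : ℕ) (T : RecTerm m) (F : ℕ → ℕ → ℕ → (Fin m → ℕ) → ℕ),
    (∀ x y z p, F x y z p = T.eval F x y z p) ∧
    ∃ (g₁ g₂ g₃ : (Fin k → ℕ) → ℕ) (h : Fin m → (Fin k → ℕ) → ℕ),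
      Primrec g₁ ∧ Primrec g₂ ∧ Primrec g₃ ∧ (∀ i, Primrec (h i)) ∧
      ∀ v, f v = F (g₁ v) (g₂ v) (g₃ v) fun i => h i v

/-! Put `A = ∏ F, Λ F`. A point of the space over `M` can be read off from a function that assigns a
letter of `A` to each finite set of points of `P`: the element `b` looks at its base and takes the
component `M.sym b`. Colourings become colourings of degree at most `τ.arity`, and it suffices to
find a set `S` on whose subsets the letter can be varied, uniformly, without changing the colour.

The proof is by induction on the degree. For degree `r + 1`, enlarge a set `E` of pairs of letters
for which the colouring is invariant at every point; once `E` is everything, the whole set of points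
is a line. A pair is added by collapsing blocks of points to single points, one block at a time,
until enough points have the new invariance; the others are frozen.

Diagonal pairs come first. For `(α, α)`, fix a set `R` of points to be kept, write `α` on all sets
with more than `r` points outside `R`, and apply the case of degree `r` outside `R`, with enlarged
alphabet and colour set (`exists_invariantAt_diagonal`). Given all diagonal pairs, only the letters
at singletons matter outside `R`, and Shelah's pigeonhole argument on a chain of sets yields `(α,
β)` (`exists_invariantAt_off_diagonal`).

The resulting bound recurses on the degree, the number of missing pairs and the number of blocks
still to be collapsed, hence is triply recursive. The same bound serves `f0`, whose colourings are
among those for `f1`. -/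

/-- The subspace of dimension one given by `S`: on the subsets of `S` the value is `p`. -/
def lineUpdate {V A : Type*} [DecidableEq V] (S : Finset V) (ξ : Finset V → A) (p : A) :
    Finset V → A := fun B => if B ⊆ S then p else ξ B

/-- A colouring of the set-indexed space over `V` has a monochromatic line. -/
def HasSetLine {V A C : Type*} [DecidableEq V] (d : (Finset V → A) → C) : Prop :=
  ∃ S : Finset V, S.Nonempty ∧ ∃ ξ : Finset V → A, ∀ p p' : A,
    d (lineUpdate S ξ p) = d (lineUpdate S ξ p')

/-- The colouring depends only on the coordinates that are non-empty sets of at most `r` points. -/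
def DegreeLE {V A C : Type*} (r : ℕ) (d : (Finset V → A) → C) : Prop :=
  ∀ ξ ξ' : Finset V → A, (∀ B : Finset V, B.Nonempty → B.card ≤ r → ξ B = ξ' B) → d ξ = d ξ'

/-- The colouring does not notice a change of the coordinates that contain the point `a`, as long as
the values at `{a}` before and after the change form a pair from `E`. -/
def InvariantAt {V A C : Type*} (d : (Finset V → A) → C) (E : Set (A × A)) (a : V) : Prop :=
  ∀ ξ ξ' : Finset V → A, (∀ B : Finset V, a ∉ B → ξ B = ξ' B) → (ξ {a}, ξ' {a}) ∈ E → d ξ = d ξ'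

/-- Embedding of the space over `W` into the space over `V`: coordinates outside `U` are frozen, and
the others are read off after applying `g`. -/
def embedSpace {V W A : Type*} [DecidableEq V] [DecidableEq W] (U : Finset V) (g : V → W)
    (ξ₀ : Finset V → A) (ξ : Finset W → A) : Finset V → A :=
  fun B => if B ⊆ U then ξ (B.image g) else ξ₀ B

/-! ### Passing to subspaces, and invariance under change of letters -/

section Subspaces

variable {V W A C : Type*} [DecidableEq V] [DecidableEq W]

theorem HasSetLine.of_embedSpace {d : (Finset V → A) → C} {U : Finset V} {g : V → W}
    {ξ₀ : Finset V → A} (hg : ∀ w, ∃ v ∈ U, g v = w)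
    (h : HasSetLine fun ξ => d (embedSpace U g ξ₀ ξ)) : HasSetLine d := by
  obtain ⟨S, ⟨w, hw⟩, ξ, hξ⟩ := h
  obtain ⟨v, hv, rfl⟩ := hg w
  refine ⟨U.filter (g · ∈ S), ⟨v, by simp [hv, hw]⟩, embedSpace U g ξ₀ ξ, fun p p' => ?_⟩
  have key : ∀ p, lineUpdate (U.filter (g · ∈ S)) (embedSpace U g ξ₀ ξ) p =
      embedSpace U g ξ₀ (lineUpdate S ξ p) := by
    intro p
    funext B
    have hB : B ⊆ U.filter (g · ∈ S) ↔ B ⊆ U ∧ B.image g ⊆ S := by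
      simp only [Finset.subset_iff, Finset.mem_filter, Finset.mem_image]
      grind
    simp only [lineUpdate, embedSpace, hB]
    split_ifs <;> tauto
  rw [key, key]
  exact hξ p p'

theorem DegreeLE.comp_embedSpace {r : ℕ} {d : (Finset V → A) → C} (hd : DegreeLE r d) (U : Finset V)
    (g : V → W) (ξ₀ : Finset V → A) : DegreeLE r fun ξ => d (embedSpace U g ξ₀ ξ) := by
  intro ξ ξ' h
  refine hd _ _ fun B hB hr => ?_
  simp only [embedSpace]
  rw [h _ (hB.image g) (Finset.card_image_le.trans hr)]

/-- The points of `J` are treated one at a time: rewriting the sets that contain `a` leaves the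
letters at the other singletons alone. -/
theorem InvariantAt.eq_of_forall {d : (Finset V → A) → C} {E : Set (A × A)} (J : Finset V) :
    (∀ a ∈ J, InvariantAt d E a) → ∀ ξ ξ' : Finset V → A,
      (∀ B : Finset V, Disjoint B J → ξ B = ξ' B) → (∀ a ∈ J, (ξ {a}, ξ' {a}) ∈ E) →
        d ξ = d ξ' := by
  induction J using Finset.induction_on with
  | empty =>
    intro _ ξ ξ' h _
    rw [show ξ = ξ' from funext fun B => h B (Finset.disjoint_empty_right _)]
  | insert a J ha ih =>
    intro hinv ξ ξ' h hE
    have h1 : d ξ = d (fun B => if a ∈ B then ξ' B else ξ B) := by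
      refine hinv a (Finset.mem_insert_self _ _) _ _ (fun B hB => by simp [hB]) ?_
      simpa using hE a (Finset.mem_insert_self _ _)
    rw [h1]
    refine ih (fun b hb => hinv b (Finset.mem_insert_of_mem hb)) _ _ (fun B hB => ?_)
      (fun b hb => ?_)
    · by_cases haB : a ∈ B
      · simp [haB]
      · simp only [haB, if_false]
        exact h B (by simp [Finset.disjoint_insert_right, haB, hB])
    · have hab : a ≠ b := fun e => ha (e ▸ hb)
      simpa [hab] using hE b (Finset.mem_insert_of_mem hb)

/-- A change at `w` pulls back to a change of sets that meet the fibre of `w`, and each singleton in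
the fibre sees the same pair of letters. -/
theorem InvariantAt.comp_embedSpace {d : (Finset V → A) → C} {E : Set (A × A)} {U : Finset V}
    {g : V → W} (ξ₀ : Finset V → A) {w : W} (h : ∀ v ∈ U, g v = w → InvariantAt d E v) :
    InvariantAt (fun ξ => d (embedSpace U g ξ₀ ξ)) E w := by
  intro ξ ξ' hξ hE
  refine InvariantAt.eq_of_forall (E := E) (U.filter (g · = w)) (fun v hv => ?_) _ _ (fun B hB => ?_)
    (fun v hv => ?_)
  · rw [Finset.mem_filter] at hv
    exact h v hv.1 hv.2
  · by_cases hU : B ⊆ U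
    · simp only [embedSpace, hU, if_true]
      refine hξ _ fun hw => ?_
      obtain ⟨v, hv, rfl⟩ := Finset.mem_image.1 hw
      exact Finset.disjoint_left.1 hB hv (by simp [hU hv])
    · simp [embedSpace, hU]
  · rw [Finset.mem_filter] at hv
    simpa [embedSpace, hv.1, hv.2] using hE

theorem InvariantAt.union {V A C : Type*} {d : (Finset V → A) → C} {E E' : Set (A × A)} {a : V}
    (h : InvariantAt d E a) (h' : InvariantAt d E' a) : InvariantAt d (E ∪ E') a :=
  fun ξ ξ' hξ hE => hE.elim (h ξ ξ' hξ) (h' ξ ξ' hξ)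

theorem HasSetLine.of_invariantAt_univ [Fintype V] [Nonempty V] [Nonempty A] {r : ℕ}
    {d : (Finset V → A) → C} (hd : DegreeLE r d) (h : ∀ a, InvariantAt d Set.univ a) :
    HasSetLine d := by
  refine ⟨Finset.univ, Finset.univ_nonempty, fun _ => Classical.arbitrary A, fun p p' => ?_⟩
  -- The two points of the line also differ at `∅`, which no invariance controls; the degree
  -- condition ignores that coordinate.
  rw [hd _ (fun B => if B = ∅ then p' else p) fun B hB _ => by simp [lineUpdate, hB.ne_empty]]
  refine InvariantAt.eq_of_forall Finset.univ (fun a _ => h a) _ _ (fun B hB => ?_)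
    (fun _ _ => Set.mem_univ _)
  have : B = ∅ :=
    Finset.eq_empty_of_forall_notMem fun x hx => Finset.disjoint_left.1 hB hx (Finset.mem_univ x)
  simp [this, lineUpdate]

end Subspaces

/-! ### Collapsing a block to a point -/

/-- The map that sends the points of `R` to themselves and all others to a new point. -/
def collapse {V : Type*} [DecidableEq V] (R : Finset V) (x : V) : Option R :=
  if h : x ∈ R then some ⟨x, h⟩ else none

/-- The trace of a set on a subset, as a set of elements of the subtype. -/
def traceOn {V : Type*} [DecidableEq V] (R B : Finset V) : Finset R := R.attach.filter (↑· ∈ B)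

section Collapse

variable {V A C : Type*} [DecidableEq V] {R : Finset V}

@[simp] theorem mem_traceOn {B : Finset V} {x : R} : x ∈ traceOn R B ↔ (x : V) ∈ B := by
  simp [traceOn]

theorem image_collapse_of_subset {B : Finset V} (h : B ⊆ R) :
    B.image (collapse R) = (traceOn R B).image some := by
  ext x
  simp only [Finset.mem_image, mem_traceOn, collapse]
  grind

theorem image_collapse_of_not_subset {B : Finset V} (h : ¬ B ⊆ R) :
    B.image (collapse R) = insert none ((traceOn R B).image some) := by
  obtain ⟨v, hv, hvR⟩ := Finset.not_subset.1 h
  ext x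
  rcases x with _ | x
  · simp only [Finset.mem_image, Finset.mem_insert, true_or, iff_true]
    exact ⟨v, hv, by simp [collapse, hvR]⟩
  · simp only [Finset.mem_image, mem_traceOn, collapse, Finset.mem_insert]
    grind

theorem collapse_surjOn {S : Finset V} (hS : S.Nonempty) (hSR : Disjoint S R) (w : Option R) :
    ∃ v ∈ S ∪ R, collapse R v = w := by
  rcases w with _ | w
  · obtain ⟨v, hv⟩ := hS
    exact ⟨v, by simp [hv], by simp [collapse, Finset.disjoint_left.1 hSR hv]⟩
  · exact ⟨w, by simp, by simp [collapse]⟩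

end Collapse

/-! ### Gaining one invariant pair -/

/-- The function that is `ρ` on the subsets of `R`, `χ` on sets with at most `r` points in `T`, and
`α` on sets with more than `r` points in `T`. -/
def glue {V A : Type*} [DecidableEq V] (R T : Finset V) (r : ℕ) (α : A)
    (χ : Finset T → Finset R → A) (ρ : Finset R → A) : Finset V → A := fun B =>
  if B ⊆ R then ρ (traceOn R B)
  else if r < (traceOn T B).card then α else χ (traceOn T B) (traceOn R B)

section Steps

variable {V A C : Type*} [Fintype V] [DecidableEq V] {R : Finset V}

theorem traceOn_compl_nonempty {B : Finset V} (h : ¬ B ⊆ R) : (traceOn Rᶜ B).Nonempty := by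
  obtain ⟨v, hv, hvR⟩ := Finset.not_subset.1 h
  exact ⟨⟨v, by simpa using hvR⟩, by simpa using hv⟩

theorem card_traceOn_compl_add (B : Finset V) :
    (traceOn Rᶜ B).card + (traceOn R B).card = B.card := by
  have h : ∀ T : Finset V, (traceOn T B).card = (B.filter (· ∈ T)).card := by
    intro T
    rw [← Finset.card_image_of_injective (traceOn T B) Subtype.val_injective]
    congr 1
    ext x
    simp only [Finset.mem_image, mem_traceOn, Subtype.exists, Finset.mem_filter]
    grind
  rw [h, h, add_comm, ← Finset.card_filter_add_card_filter_not (s := B) (· ∈ R)]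
  simp only [Finset.mem_compl]

/-- Larger traces outside `R` carry the constant `α`, so they do not read `χ`. The new colour is a
function of `ρ`, so that a single line serves all `ρ` at once. -/
theorem degreeLE_glue (d : (Finset V → A) → C) (r : ℕ) (α : A) :
    DegreeLE r fun (χ : Finset ↥Rᶜ → Finset R → A) (ρ : Finset R → A) =>
      d (glue R Rᶜ r α χ ρ) := by
  intro χ χ' h
  funext ρ
  refine congrArg d (funext fun B => ?_)
  simp only [glue]
  split_ifs with h1 h2
  · rfl
  · rfl
  · rw [h _ (traceOn_compl_nonempty h1) (not_lt.1 h2)]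

/-- Collapsing `S` to `none` turns the letter `p` of the line, itself a function on `Finset R`, into
`D ↦ ξ (insert none (D.image some))`. -/
theorem exists_invariantAt_diagonal {r : ℕ} {d : (Finset V → A) → C} (hd : DegreeLE (r + 1) d)
    {α : A} (h : HasSetLine fun (χ : Finset ↥Rᶜ → Finset R → A) (ρ : Finset R → A) =>
      d (glue R Rᶜ r α χ ρ)) :
    ∃ S : Finset V, S.Nonempty ∧ Disjoint S R ∧ ∃ ξ₀ : Finset V → A,
      InvariantAt (fun ξ => d (embedSpace (S ∪ R) (collapse R) ξ₀ ξ)) {(α, α)} none := by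
  obtain ⟨S, hS, χ, hχ⟩ := h
  refine ⟨S.image Subtype.val, hS.image _, ?_, fun B =>
    if r < (traceOn Rᶜ B).card then α else χ (traceOn Rᶜ B) (traceOn R B), ?_⟩
  · rw [Finset.disjoint_left]
    intro x hx
    obtain ⟨y, -, rfl⟩ := Finset.mem_image.1 hx
    exact Finset.mem_compl.1 y.2
  have hsub : ∀ B : Finset V, B ⊆ S.image Subtype.val ∪ R ↔ traceOn Rᶜ B ⊆ S := by
    intro B
    simp only [Finset.subset_iff, mem_traceOn, Finset.mem_union, Finset.mem_image, Subtype.forall,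
      Subtype.exists, Finset.mem_compl]
    grind
  have key : ∀ ξ : Finset (Option R) → A, ξ {none} = α →
      d (embedSpace (S.image Subtype.val ∪ R) (collapse R) (fun B =>
        if r < (traceOn Rᶜ B).card then α else χ (traceOn Rᶜ B) (traceOn R B)) ξ) =
      d (glue R Rᶜ r α (lineUpdate S χ fun D => ξ (insert none (D.image some)))
        fun D => ξ (D.image some)) := by
    intro ξ hξ
    refine hd _ _ fun B hB hr => ?_
    have hcard := card_traceOn_compl_add (R := R) B
    simp only [embedSpace, glue, lineUpdate, hsub]
    by_cases hBR : B ⊆ R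
    · have : traceOn Rᶜ B ⊆ S := by
        intro x hx
        exact absurd (hBR (mem_traceOn.1 hx)) (Finset.mem_compl.1 x.2)
      simp [this, hBR, image_collapse_of_subset hBR]
    · by_cases hT : traceOn Rᶜ B ⊆ S
      · simp only [hT, if_true, hBR, if_false, image_collapse_of_not_subset hBR]
        split_ifs with hlt
        -- At most `r + 1` points in all and more than `r` outside `R` leave none in `R`. So `B`
        -- collapses to `{none}`, where the letter is `α`, as `glue` prescribes.
        · have : traceOn R B = ∅ := by
            rw [← Finset.card_eq_zero]
            omega
          simpa [this] using hξ
        · rfl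
      · simp [hT, hBR]
  intro ξ ξ' hξ hE
  obtain ⟨h1, h2⟩ := Prod.ext_iff.1 (Set.mem_singleton_iff.1 hE)
  refine (key ξ h1).trans (Eq.trans ?_ (key ξ' h2).symm)
  have : (fun D : Finset R => ξ (D.image some)) = fun D => ξ' (D.image some) :=
    funext fun D => hξ _ (by simp)
  rw [this]
  exact congrFun (hχ _ _) _

/-- Along a chain of sets, with `α` on the set and `β` off it, two stages must have the same colour
for every `ρ`; their difference is the block. -/
theorem exists_invariantAt_off_diagonal [Fintype A] [Fintype C] [Nonempty C]
    {d : (Finset V → A) → C} {E : Set (A × A)} (hE : ∀ a, InvariantAt d E a)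
    (hdiag : ∀ γ, (γ, γ) ∈ E) (α β : A)
    (hcard : Nat.card ((Finset R → A) → C) ≤ Rᶜ.card) :
    ∃ S : Finset V, S.Nonempty ∧ Disjoint S R ∧ ∃ ξ₀ : Finset V → A,
      InvariantAt (fun ξ => d (embedSpace (S ∪ R) (collapse R) ξ₀ ξ)) {(α, β)} none := by
  let state : Finset V → (Finset R → A) → Finset V → A := fun J ρ B =>
    if B ⊆ R then ρ (traceOn R B) else if (B ∩ J).Nonempty then α else β
  let e := Rᶜ.equivFin
  let J : ℕ → Finset V := fun j => (Rᶜ.attach.filter fun x => (e x : ℕ) < j).image Subtype.val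
  have hJ : ∀ j x, x ∈ J j ↔ ∃ h : x ∈ Rᶜ, (e ⟨x, h⟩ : ℕ) < j := by
    intro j x
    simp [J]
  -- There are `Rᶜ.card + 1` initial segments and at most `Rᶜ.card` functions of `ρ`.
  obtain ⟨i, j, hij, hst⟩ : ∃ i j : Fin (Rᶜ.card + 1), i < j ∧
      (fun ρ => d (state (J i) ρ)) = fun ρ => d (state (J j) ρ) := by
    classical
    obtain ⟨i, j, hne, heq⟩ := Fintype.exists_ne_map_eq_of_card_lt
      (fun (j : Fin (Rᶜ.card + 1)) (ρ : Finset R → A) => d (state (J j) ρ))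
      (by rw [Fintype.card_fin, ← Nat.card_eq_fintype_card]; omega)
    rcases lt_or_gt_of_ne hne with h | h
    · exact ⟨i, j, h, heq⟩
    · exact ⟨j, i, h, heq.symm⟩
  have hsub : J i ⊆ J j := by
    intro x
    rw [hJ, hJ]
    rintro ⟨h, h'⟩
    exact ⟨h, h'.trans hij⟩
  have hJR : ∀ k x, x ∈ J k → x ∉ R := fun k x hx => Finset.mem_compl.1 ((hJ _ _).1 hx).1
  have hSR : Disjoint (J j \ J i) R :=
    Finset.disjoint_left.2 fun x hx => hJR j x (Finset.mem_sdiff.1 hx).1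
  let ξ₀ : Finset V → A := fun B => if (B ∩ J i).Nonempty then α else β
  refine ⟨J j \ J i, ?_, hSR, ξ₀, ?_⟩
  · refine ⟨e.symm ⟨i, by omega⟩, ?_⟩
    rw [Finset.mem_sdiff, hJ, hJ]
    simp [hij]
  -- Because `E` contains the diagonal, agreement on the subsets of `R` and on the singletons
  -- outside `R` already gives equal colours.
  have key : ∀ (ξ : Finset (Option R) → A) (K : Finset V) ,
      (∀ x, x ∉ R → ξ₀ {x} = (if x ∈ K then α else β) ∨ x ∈ J j \ J i) →
      (∀ x ∈ J j \ J i, ξ {none} = if x ∈ K then α else β) →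
      d (embedSpace (J j \ J i ∪ R) (collapse R) ξ₀ ξ) =
        d (state K fun D => ξ (D.image some)) := by
    intro ξ K h0 h1
    refine InvariantAt.eq_of_forall (E := E) Rᶜ (fun a _ => hE a) _ _ (fun B hB => ?_)
      (fun x hx => ?_)
    · have hBR : B ⊆ R := by
        intro x hx
        simpa using Finset.disjoint_left.1 hB hx
      simp [state, embedSpace, hBR, hBR.trans Finset.subset_union_right,
        image_collapse_of_subset hBR]
    · have hxR : x ∉ R := Finset.mem_compl.1 hx
      have : embedSpace (J j \ J i ∪ R) (collapse R) ξ₀ ξ {x} =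
          state K (fun D => ξ (D.image some)) {x} := by
        have hK : (({x} : Finset V) ∩ K).Nonempty ↔ x ∈ K := by
          simp [Finset.Nonempty]
        by_cases hxS : x ∈ J j \ J i
        · have := h1 x hxS
          have hU : ({x} : Finset V) ⊆ J j \ J i ∪ R := by
            rw [Finset.singleton_subset_iff]
            exact Finset.mem_union_left _ hxS
          simp only [embedSpace, state, Finset.singleton_subset_iff, hxR, hU, hK, if_true,
            if_false, Finset.image_singleton]
          simpa [collapse, hxR] using this
        · have := (h0 x hxR).resolve_right hxS
          have hU : ¬ ({x} : Finset V) ⊆ J j \ J i ∪ R := by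
            rw [Finset.singleton_subset_iff, Finset.mem_union]
            tauto
          simp only [embedSpace, state, Finset.singleton_subset_iff, hxR, hU, hK, if_false]
          exact this
      rw [this]
      exact hdiag _
  have hξ₀ : ∀ x, ξ₀ {x} = if x ∈ J i then α else β := by
    intro x
    have : (({x} : Finset V) ∩ J i).Nonempty ↔ x ∈ J i := by simp [Finset.Nonempty]
    simp only [ξ₀, this]
  intro ξ ξ' hξ hmem
  obtain ⟨hα, hβ⟩ := Prod.ext_iff.1 (Set.mem_singleton_iff.1 hmem)
  simp only at hα hβ
  -- The letter `α` on the block produces the stage `J j`, and `β` produces `J i`; off the block the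
  -- two stages agree.
  have e1 := key ξ (J j)
    (fun x hx => by
      rw [hξ₀]
      by_cases h1 : x ∈ J i
      · simp [h1, hsub h1]
      · by_cases h2 : x ∈ J j <;> simp [h1, h2])
    (fun x hx => by rw [if_pos (Finset.mem_sdiff.1 hx).1, hα])
  have e2 := key ξ' (J i) (fun x hx => Or.inl (hξ₀ x))
    (fun x hx => by rw [if_neg (Finset.mem_sdiff.1 hx).2, hβ])
  refine e1.trans (Eq.trans ?_ e2.symm)
  have : (fun D : Finset R => ξ (D.image some)) = fun D => ξ' (D.image some) :=
    funext fun D => hξ _ (by simp)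
  rw [this]
  exact (congrFun hst fun D => ξ' (D.image some)).symm

end Steps

/-! ### Numerical bounds and the induction on the degree -/

/-- One step of the recursion for the number of points: `N` bounds the number of points needed for
the next lower degree. -/
def collapseStep (N : ℕ → ℕ → ℕ) (q c x : ℕ) : ℕ :=
  x + N (q ^ 2 ^ x) (c ^ q ^ 2 ^ x) + c ^ q ^ 2 ^ x

/-- The number of points that suffice when all but `y` pairs of letters are invariant. -/
def pairBound (N : ℕ → ℕ → ℕ) (q c : ℕ) : ℕ → ℕ
  | 0 => 1
  | y + 1 => (collapseStep N q c)^[pairBound N q c y] (pairBound N q c y)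

/-- The number of points that suffice for colourings of degree at most `r` with `c` colours over an
alphabet of `q` letters. -/
def lineBound : ℕ → ℕ → ℕ → ℕ
  | 0, _, _ => 1
  | r + 1, q, c => pairBound (lineBound r) q c (q ^ 2)

theorem le_collapseStep_iterate (N : ℕ → ℕ → ℕ) (q c x z : ℕ) :
    x ≤ (collapseStep N q c)^[z] x := by
  refine Function.id_le_iterate_of_id_le (fun y => ?_) z x
  simp only [collapseStep, id]
  omega

theorem one_le_pairBound (N : ℕ → ℕ → ℕ) (q c y : ℕ) : 1 ≤ pairBound N q c y := by
  induction y with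
  | zero => exact le_rfl
  | succ y ih => exact ih.trans (le_collapseStep_iterate _ _ _ _ _)

theorem one_le_lineBound (r q c : ℕ) : 1 ≤ lineBound r q c := by
  cases r with
  | zero => exact le_rfl
  | succ r => exact one_le_pairBound _ _ _ _

section Bounds

/-- Every colouring of degree at most `r` with at most `c` colours, over at most `q` letters and at
least `N` points, has a monochromatic line. -/
def SetLineBound (r q c N : ℕ) : Prop :=
  ∀ (V A C : Type u) [Finite V] [DecidableEq V] [Finite A] [Nonempty A] [Finite C]
    (d : (Finset V → A) → C), DegreeLE r d → Nat.card A ≤ q → Nat.card C ≤ c → N ≤ Nat.card V →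
      HasSetLine d

theorem setLineBound_zero (q c : ℕ) : SetLineBound.{u} 0 q c 1 := by
  intro V A C _ _ _ _ _ d hd _ _ hV
  obtain ⟨v⟩ : Nonempty V := (Nat.card_pos_iff.1 hV).1
  refine ⟨{v}, Finset.singleton_nonempty v, fun _ => Classical.arbitrary A, fun p p' => ?_⟩
  refine hd _ _ fun B hB h0 => absurd h0 ?_
  have := hB.card_pos
  omega

variable {A C : Type u} [Finite A] [Nonempty A] [Finite C]

/-- A block outside `R` can be collapsed to a point that is invariant for one more pair. -/
theorem exists_invariantAt_pair {N : ℕ → ℕ → ℕ} {r q c : ℕ}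
    (hN : ∀ q c, SetLineBound.{u} r q c (N q c)) (hA : Nat.card A ≤ q) (hC : Nat.card C ≤ c)
    {V : Type u} [Fintype V] [DecidableEq V] {d : (Finset V → A) → C} (hd : DegreeLE (r + 1) d)
    {E : Set (A × A)} (hE : ∀ a, InvariantAt d E a) {α β : A}
    (hαβ : α = β ∨ ∀ γ, (γ, γ) ∈ E) {R : Finset V}
    (hV : collapseStep N q c R.card ≤ Fintype.card V) :
    ∃ S : Finset V, S.Nonempty ∧ Disjoint S R ∧ ∃ ξ₀ : Finset V → A,
      InvariantAt (fun ξ => d (embedSpace (S ∪ R) (collapse R) ξ₀ ξ)) {(α, β)} none := by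
  have := Fintype.ofFinite A
  have := Fintype.ofFinite C
  have : Nonempty C := ⟨d fun _ => Classical.arbitrary A⟩
  have hq : 1 ≤ q := Nat.card_pos.trans_le hA
  have hc : 1 ≤ c := Nat.card_pos.trans_le hC
  have hA' : Nat.card (Finset R → A) ≤ q ^ 2 ^ R.card := by
    rw [Nat.card_fun, Nat.card_eq_fintype_card (α := Finset R), Fintype.card_finset,
      Fintype.card_coe]
    exact Nat.pow_le_pow_left hA _
  have hC' : Nat.card ((Finset R → A) → C) ≤ c ^ q ^ 2 ^ R.card := by
    rw [Nat.card_fun]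
    exact (Nat.pow_le_pow_left hC _).trans (Nat.pow_le_pow_right hc hA')
  have hR : Rᶜ.card = Fintype.card V - R.card := Finset.card_compl R
  simp only [collapseStep] at hV
  rcases hαβ with rfl | hdiag
  · refine exists_invariantAt_diagonal hd (hN _ _ _ _ _ _ (degreeLE_glue d r α) hA' hC' ?_)
    rw [Nat.card_eq_fintype_card, Fintype.card_coe]
    omega
  · exact exists_invariantAt_off_diagonal hE hdiag α β (by omega)

/-- Here `D` holds the points that already have the new invariance and `z` counts the collapses
still allowed. Once `D` has `K` points, `hline`, the case with one pair fewer missing, applies on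
`D`. -/
theorem hasSetLine_of_invariantAt_on {N : ℕ → ℕ → ℕ} {r q c : ℕ}
    (hN : ∀ q c, SetLineBound.{u} r q c (N q c)) (hA : Nat.card A ≤ q) (hC : Nat.card C ≤ c)
    {E : Set (A × A)} {α β : A} (hαβ : α = β ∨ ∀ γ, (γ, γ) ∈ E) {K : ℕ} (hK : 1 ≤ K)
    (hline : ∀ (V : Type u) [Fintype V] [DecidableEq V] (d : (Finset V → A) → C),
      DegreeLE (r + 1) d → (∀ a, InvariantAt d (insert (α, β) E) a) → K ≤ Fintype.card V →
        HasSetLine d) (z : ℕ) :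
    ∀ (V : Type u) [Fintype V] [DecidableEq V] (d : (Finset V → A) → C), DegreeLE (r + 1) d →
      (∀ a, InvariantAt d E a) → ∀ D : Finset V, (∀ a ∈ D, InvariantAt d {(α, β)} a) →
        K ≤ D.card + z → (collapseStep N q c)^[z] K ≤ Fintype.card V → HasSetLine d := by
  induction z with
  | zero =>
    intro V _ _ d hd hE D hD hKD _
    obtain ⟨v, hv⟩ := Finset.card_pos.1 (hK.trans hKD)
    -- Everything outside `D` is frozen, so the default `v` is irrelevant.
    let g : V → D := fun x => if h : x ∈ D then ⟨x, h⟩ else ⟨v, hv⟩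
    have hg : ∀ x (h : x ∈ D), g x = ⟨x, h⟩ := fun x h => by simp [g, h]
    refine HasSetLine.of_embedSpace (U := D) (g := g) (ξ₀ := fun _ => Classical.arbitrary A)
      (fun w => ⟨w, w.2, hg _ w.2⟩) (hline D _ (hd.comp_embedSpace _ _ _) (fun a => ?_) ?_)
    · refine InvariantAt.comp_embedSpace _ fun x hx _ => ?_
      exact (hD x hx).union (hE x)
    · simpa using hKD
  | succ z ih =>
    intro V _ _ d hd hE D hD hKD hV
    rw [Function.iterate_succ_apply'] at hV
    set x := (collapseStep N q c)^[z] K with hx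
    have hKx : K ≤ x := le_collapseStep_iterate _ _ _ _ _
    have hxV : x ≤ Fintype.card V := by
      refine le_trans ?_ hV
      simp only [collapseStep]
      omega
    by_cases hlt : K ≤ D.card + z
    · exact ih V d hd hE D hD hlt hxV
    -- Now `D.card + z < K ≤ x`, so `D` fits into a set of exactly `x` points. Keeping `R` and the
    -- new point leaves `x + 1` points, enough for the next collapse.
    obtain ⟨R, hDR, -, hRx⟩ := Finset.exists_subsuperset_card_eq (Finset.subset_univ D)
      (n := x) (by omega) (by simpa using hxV)
    obtain ⟨S, hS, hSR, ξ₀, hinv⟩ := exists_invariantAt_pair hN hA hC hd hE hαβ (R := R)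
      (by rwa [hRx])
    refine HasSetLine.of_embedSpace (collapse_surjOn hS hSR) (ξ₀ := ξ₀)
      (ih (Option R) _ (hd.comp_embedSpace _ _ _)
        (fun a => InvariantAt.comp_embedSpace _ fun x _ _ => hE x)
        (insert none ((traceOn R D).image some)) (fun a ha => ?_) ?_ ?_)
    · rcases Finset.mem_insert.1 ha with rfl | ha
      · exact hinv
      · obtain ⟨y, hy, rfl⟩ := Finset.mem_image.1 ha
        refine InvariantAt.comp_embedSpace _ fun v _ hvy => ?_
        have : v = y := by
          unfold collapse at hvy
          split_ifs at hvy with h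
          rw [Option.some.injEq] at hvy
          rw [← hvy]
        rw [this]
        exact hD _ (mem_traceOn.1 hy)
    · have : (traceOn R D).card = D.card := by
        rw [← Finset.card_image_of_injective _ Subtype.val_injective]
        congr 1
        ext v
        simp only [Finset.mem_image, mem_traceOn, Subtype.exists]
        grind
      rw [Finset.card_insert_of_notMem (by simp),
        Finset.card_image_of_injective _ (Option.some_injective _), this]
      omega
    · rw [Fintype.card_option, Fintype.card_coe, hRx]
      omega

/-- Induction on the number of pairs still missing from `E`. -/
theorem hasSetLine_of_card_compl_le [Fintype A] {N : ℕ → ℕ → ℕ} {r q c : ℕ}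
    (hN : ∀ q c, SetLineBound.{u} r q c (N q c)) (hA : Nat.card A ≤ q) (hC : Nat.card C ≤ c)
    (y : ℕ) : ∀ E : Set (A × A), Eᶜ.ncard ≤ y →
      ∀ (V : Type u) [Fintype V] [DecidableEq V] (d : (Finset V → A) → C), DegreeLE (r + 1) d →
        (∀ a, InvariantAt d E a) → pairBound N q c y ≤ Fintype.card V → HasSetLine d := by
  induction y with
  | zero =>
    intro E hEc V _ _ d hd hE hV
    have : Nonempty V := Fintype.card_pos_iff.1 hV
    have hE' : E = Set.univ := by
      rwa [Nat.le_zero, Set.ncard_eq_zero, Set.compl_empty_iff] at hEc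
    exact HasSetLine.of_invariantAt_univ hd (hE' ▸ hE)
  | succ y ih =>
    intro E hEc V _ _ d hd hE hV
    by_cases huniv : E = Set.univ
    · have : Nonempty V := Fintype.card_pos_iff.1 ((one_le_pairBound _ _ _ _).trans hV)
      exact HasSetLine.of_invariantAt_univ hd (huniv ▸ hE)
    -- A missing diagonal pair has priority, since the pigeonhole step needs the whole diagonal.
    obtain ⟨α, β, hnew, hαβ⟩ : ∃ α β, (α, β) ∉ E ∧ (α = β ∨ ∀ γ, (γ, γ) ∈ E) := by
      by_cases hdiag : ∀ γ, (γ, γ) ∈ E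
      · obtain ⟨⟨α, β⟩, h⟩ := (Set.ne_univ_iff_exists_notMem _).1 huniv
        exact ⟨α, β, h, Or.inr hdiag⟩
      · obtain ⟨γ, h⟩ := not_forall.1 hdiag
        exact ⟨γ, γ, h, Or.inl rfl⟩
    have hEc' : (insert (α, β) E)ᶜ.ncard ≤ y := by
      have : (insert (α, β) E)ᶜ = Eᶜ \ {(α, β)} := by
        ext x
        simp only [Set.mem_compl_iff, Set.mem_insert_iff, Set.mem_sdiff, Set.mem_singleton_iff]
        tauto
      rw [this, Set.ncard_sdiff_singleton_of_mem hnew]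
      omega
    exact hasSetLine_of_invariantAt_on hN hA hC hαβ (one_le_pairBound N q c y) (ih _ hEc') _ V d
      hd hE ∅ (by simp) (by simp) hV

/-- A polynomial Hales–Jewett theorem, for polynomials in the sets of points. -/
theorem setLineBound_lineBound (r q c : ℕ) : SetLineBound.{u} r q c (lineBound r q c) := by
  induction r generalizing q c with
  | zero => exact setLineBound_zero q c
  | succ r ih =>
    intro V A C _ _ _ _ _ d hd hA hC hV
    have := Fintype.ofFinite V
    have := Fintype.ofFinite A
    -- Initially all pairs are missing, at most `q ^ 2` of them.
    refine hasSetLine_of_card_compl_le ih hA hC (q ^ 2) ∅ ?_ V d hd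
      (fun a ξ ξ' _ h => absurd h (Set.notMem_empty _)) (by rwa [← Nat.card_eq_fintype_card])
    rw [Set.compl_empty, Set.ncard_univ, Nat.card_prod, ← sq]
    exact Nat.pow_le_pow_left hA 2

end Bounds

/-! ### The bound is triply recursive -/

section TripleRecursion

theorem primrec_apply {k : ℕ} (i : Fin k) : Primrec fun v : Fin k → ℕ => v i :=
  Primrec.fin_app.comp Primrec.id (Primrec.const i)

theorem primrec_pow : Primrec₂ fun a b : ℕ => a ^ b := Primrec₂.unpaired'.1 Nat.Primrec.pow

/-- The choice between the clauses of the recursion for `lineBound`. -/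
def clauseChoice (v : Fin 6 → ℕ) : ℕ :=
  if v 0 = 0 ∨ v 1 = 0 then 1
  else if v 1 % 2 = 1 then (if v 2 = 0 then v 3 else v 4) else v 5

theorem primrec_clauseChoice : Primrec clauseChoice := by
  have h0 : ∀ i : Fin 6, PrimrecPred fun v : Fin 6 → ℕ => v i = 0 := fun i =>
    Primrec.eq.comp (primrec_apply i) (Primrec.const 0)
  refine Primrec.ite ((h0 0).or (h0 1)) (Primrec.const 1) (Primrec.ite ?_
    (Primrec.ite (h0 2) (primrec_apply 3) (primrec_apply 4)) (primrec_apply 5))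
  exact Primrec.eq.comp (Primrec.nat_mod.comp (primrec_apply 1) (Primrec.const 2))
    (Primrec.const 1)

namespace RecTerm

variable {m : ℕ}

/-- The constant `0`. -/
def zeroTerm : RecTerm m := .prim (r := 0) (fun _ => 0) (Primrec.const 0) ![]

/-- Truncated subtraction of a constant. -/
def subConst (t : RecTerm m) (k : ℕ) : RecTerm m :=
  .prim (fun v : Fin 1 → ℕ => v 0 - k)
    (Primrec.nat_sub.comp (primrec_apply 0) (Primrec.const k)) ![t]

/-- Twice the square. -/
def twiceSq (t : RecTerm m) : RecTerm m :=
  .prim (fun v : Fin 1 → ℕ => 2 * v 0 ^ 2)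
    (Primrec.nat_mul.comp (Primrec.const 2)
      (primrec_pow.comp (primrec_apply 0) (Primrec.const 2))) ![t]

/-- Powers. -/
def power (s t : RecTerm m) : RecTerm m :=
  .prim (fun v : Fin 2 → ℕ => v 0 ^ v 1)
    (primrec_pow.comp (primrec_apply 0) (primrec_apply 1)) ![s, t]

/-- The term `q ^ 2 ^ t`. -/
def powerTwo (q t : RecTerm m) : RecTerm m :=
  .prim (fun v : Fin 2 → ℕ => v 0 ^ 2 ^ v 1)
    (primrec_pow.comp (primrec_apply 0) (primrec_pow.comp (Primrec.const 2) (primrec_apply 1)))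
    ![q, t]

/-- The sum of three terms. -/
def sumThree (t₁ t₂ t₃ : RecTerm m) : RecTerm m :=
  .prim (fun v : Fin 3 → ℕ => v 0 + v 1 + v 2)
    (Primrec.nat_add.comp (Primrec.nat_add.comp (primrec_apply 0) (primrec_apply 1))
      (primrec_apply 2)) ![t₁, t₂, t₃]

/-- The preceding value in an iteration of `collapseStep`. -/
def previousIterate : RecTerm 3 :=
  .call .x .y (subConst .z 1) ![.param 0, .param 1, .param 2]

/-- The alphabet size for the lower degree. -/
def blockAlphabet : RecTerm 3 := powerTwo (.param 0) previousIterate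

/-- The number of colours for the lower degree. -/
def blockColours : RecTerm 3 := power (.param 1) blockAlphabet

/-- The value of `collapseStep` at the preceding iterate. -/
def iterateClause : RecTerm 3 :=
  sumThree previousIterate
    (.call (subConst .x 1) (twiceSq blockAlphabet) zeroTerm
      ![blockAlphabet, blockColours, zeroTerm]) blockColours

/-- The preceding value of `pairBound`. -/
def previousPairBound : RecTerm 3 :=
  .call .x (subConst .y 2) zeroTerm ![.param 0, .param 1, zeroTerm]

/-- The next value of `pairBound`. -/
def pairClause : RecTerm 3 :=
  .call .x (subConst .y 1) previousPairBound ![.param 0, .param 1, previousPairBound]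

/-- The right-hand side of the triple recursion behind `lineBound`. -/
def lineBoundTerm : RecTerm 3 :=
  .prim clauseChoice primrec_clauseChoice
    ![.x, .y, .z, .param 2, iterateClause, pairClause]

end RecTerm

/-- The function of three recursion variables and three parameters `q`, `c` and `K` that contains
both `pairBound` (at even second arguments) and the iterates of `collapseStep` at `K` (at odd
ones). -/
def lineRec (x y z : ℕ) (p : Fin 3 → ℕ) : ℕ :=
  if x = 0 ∨ y = 0 then 1
  else if y % 2 = 1 then (collapseStep (lineBound (x - 1)) (p 0) (p 1))^[z] (p 2)
  else pairBound (lineBound (x - 1)) (p 0) (p 1) (y / 2)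

/-- Half of `2 * q ^ 2` is the number of pairs from which `lineBound` starts. For `q = 0` the first
clause of `lineRec` answers, and both sides are `1`. -/
theorem lineRec_twice_sq {r q c : ℕ} {p : Fin 3 → ℕ} (hq : p 0 = q) (hc : p 1 = c) :
    lineRec r (2 * q ^ 2) 0 p = lineBound r q c := by
  subst hq hc
  rcases r with _ | r
  · simp [lineRec, lineBound]
  · rcases Nat.eq_zero_or_pos (p 0) with hq | hq
    · simp [lineRec, lineBound, pairBound, hq]
    · simp [lineRec, lineBound, hq.ne']

/-- All calls that matter descend lexicographically: an iterate lowers `z`, or lowers `x` with a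
large new `y`; a pair bound lowers `y` with a large new `z`. Values of the clauses not chosen are
discarded. -/
theorem lineRec_eq_eval (x y z : ℕ) (p : Fin 3 → ℕ) :
    lineRec x y z p = RecTerm.lineBoundTerm.eval lineRec x y z p := by
  rcases x with _ | r
  · simp [lineRec, RecTerm.lineBoundTerm, RecTerm.eval, clauseChoice]
  rcases y with _ | y
  · simp [lineRec, RecTerm.lineBoundTerm, RecTerm.eval, clauseChoice]
  rcases Nat.even_or_odd' y with ⟨j, rfl | rfl⟩
  · have hodd : (2 * j + 1) % 2 = 1 := by omega
    rcases z with _ | z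
    · simp [lineRec, RecTerm.lineBoundTerm, RecTerm.eval, clauseChoice, hodd]
    · have hprev : RecTerm.previousIterate.eval lineRec (r + 1) (2 * j + 1) (z + 1) p =
          (collapseStep (lineBound r) (p 0) (p 1))^[z] (p 2) := by
        simp [RecTerm.previousIterate, RecTerm.eval, RecTerm.subConst, lineRec, hodd]
      have hclause : RecTerm.iterateClause.eval lineRec (r + 1) (2 * j + 1) (z + 1) p =
          (collapseStep (lineBound r) (p 0) (p 1))^[z + 1] (p 2) := by
        rw [Function.iterate_succ_apply']
        simp only [RecTerm.iterateClause, RecTerm.sumThree, RecTerm.twiceSq, RecTerm.eval]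
        have halph : RecTerm.blockAlphabet.eval lineRec (r + 1) (2 * j + 1) (z + 1) p =
            p 0 ^ 2 ^ (collapseStep (lineBound r) (p 0) (p 1))^[z] (p 2) := by
          simp [RecTerm.blockAlphabet, RecTerm.powerTwo, RecTerm.eval, hprev]
        have hcol : RecTerm.blockColours.eval lineRec (r + 1) (2 * j + 1) (z + 1) p =
            p 1 ^ p 0 ^ 2 ^ (collapseStep (lineBound r) (p 0) (p 1))^[z] (p 2) := by
          simp [RecTerm.blockColours, RecTerm.power, RecTerm.eval, halph]
        simp [RecTerm.eval, RecTerm.subConst, RecTerm.zeroTerm, hprev, halph, hcol,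
          lineRec_twice_sq, collapseStep]
      simp only [RecTerm.lineBoundTerm, RecTerm.eval, clauseChoice]
      simp [hclause, lineRec, hodd, RecTerm.eval]
  · have hne : (2 * j + 1 + 1) % 2 ≠ 1 := by omega
    have hodd : (2 * j + 1) % 2 = 1 := by omega
    have hdiv : (2 * j + 1 + 1) / 2 = j + 1 := by omega
    have hprev : RecTerm.previousPairBound.eval lineRec (r + 1) (2 * j + 1 + 1) z p =
        pairBound (lineBound r) (p 0) (p 1) j := by
      rcases j with _ | j
      · simp [RecTerm.previousPairBound, RecTerm.eval, RecTerm.subConst, lineRec, pairBound]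
      · simp [RecTerm.previousPairBound, RecTerm.eval, RecTerm.subConst, lineRec]
    have hclause : RecTerm.pairClause.eval lineRec (r + 1) (2 * j + 1 + 1) z p =
        pairBound (lineBound r) (p 0) (p 1) (j + 1) := by
      simp [RecTerm.pairClause, RecTerm.eval, RecTerm.subConst, hprev, lineRec, hodd, pairBound]
    simp only [RecTerm.lineBoundTerm, RecTerm.eval, clauseChoice]
    simp [hclause, lineRec, hne, hdiv, RecTerm.eval]

theorem tripleRecursive_lineBound {k : ℕ} (r s m c : Fin k) :
    TripleRecursive fun v : Fin k → ℕ => lineBound (v r) (v m ^ v s) (v c) := by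
  have hq : Primrec fun v : Fin k → ℕ => v m ^ v s :=
    primrec_pow.comp (primrec_apply m) (primrec_apply s)
  refine ⟨3, RecTerm.lineBoundTerm, lineRec, lineRec_eq_eval, fun v => v r,
    fun v => 2 * (v m ^ v s) ^ 2, fun _ => 0,
    ![fun v => v m ^ v s, fun v => v c, fun _ => 0], primrec_apply r,
    Primrec.nat_mul.comp (Primrec.const 2) (primrec_pow.comp hq (Primrec.const 2)),
    Primrec.const 0, fun i => ?_, fun v => ?_⟩
  · fin_cases i
    · exact hq
    · exact primrec_apply c
    · exact Primrec.const 0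
  · change lineBound (v r) (v m ^ v s) (v c) = lineRec (v r) (2 * (v m ^ v s) ^ 2) 0
      fun i => ![fun v : Fin k → ℕ => v m ^ v s, fun v => v c, fun _ => 0] i v
    rw [lineRec_twice_sq (q := v m ^ v s) (c := v c)] <;> rfl

end TripleRecursion

/-! ### From full index models to set-indexed spaces -/

namespace Fim

variable {τ : Vocabulary.{u}} (M : Fim τ)

instance : Finite M.Carrier := M.finite_carrier

/-- By symmetry any presentation can be sorted, and sorted presentations are unique; sorting keeps
the range. -/
theorem base_fn (F : τ.Sym) (a : Fin (τ.symArity F) → M.P) : M.base (M.fn F a) = Set.range a := by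
  ext x
  constructor
  · rintro ⟨G, b, h, i, rfl⟩
    have h' := M.fn_inj _ _ (b ∘ Tuple.sort b) (a ∘ Tuple.sort a)
      (Tuple.monotone_sort b) (Tuple.monotone_sort a) (by rw [M.fn_symm, M.fn_symm, h])
    have h'' := congrArg (fun s : Σ F : τ.Sym, (Fin (τ.symArity F) → M.P) => Set.range s.2) h'
    simp only [EquivLike.range_comp] at h''
    exact h'' ▸ Set.mem_range_self i
  · rintro ⟨i, rfl⟩
    exact ⟨F, a, rfl, i, rfl⟩

theorem base_coe (x : M.P) : M.base x = {x} := by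
  have h : M.fn τ.ident (fun _ => x) = x := M.fn_ident _ ⟨0, τ.symArity_pos _⟩
  have : Nonempty (Fin (τ.symArity τ.ident)) := ⟨⟨0, τ.symArity_pos _⟩⟩
  rw [← h, base_fn, Set.range_const]

theorem base_nonempty (b : M.Carrier) : (M.base b).Nonempty := by
  obtain ⟨F, a, rfl⟩ := M.exists_fn b
  rw [base_fn]
  exact ⟨_, ⟨0, τ.symArity_pos F⟩, rfl⟩

theorem ncard_base_le (b : M.Carrier) : (M.base b).ncard ≤ τ.arity := by
  obtain ⟨F, a, rfl⟩ := M.exists_fn b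
  rw [base_fn, ← Set.image_univ]
  refine (Set.ncard_image_le).trans ?_
  rw [Set.ncard_univ, Nat.card_eq_fintype_card, Fintype.card_fin]
  exact Finset.le_sup (f := τ.symArity) (Finset.mem_univ F)

theorem mem_cl_iff {A : Set M.Carrier} (hA : A ⊆ M.P) {b : M.Carrier} :
    b ∈ M.cl A ↔ ∀ x ∈ M.base b, (x : M.Carrier) ∈ A := by
  constructor
  · intro h
    refine Set.mem_sInter.1 h {b | ∀ x ∈ M.base b, (x : M.Carrier) ∈ A} ⟨fun F a => ?_, ?_⟩
    · simp only [Set.mem_ofPred_eq, base_fn, base_coe, Set.forall_mem_range,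
        Set.mem_singleton_iff, forall_eq]
    · intro x hx y hy
      have := M.base_coe ⟨x, hA hx⟩
      rw [show y = ⟨x, hA hx⟩ by simpa [this] using hy]
      exact hx
  · rintro h B ⟨hB, hAB⟩
    obtain ⟨F, a, rfl⟩ := M.exists_fn b
    rw [base_fn] at h
    exact (hB F a).2 fun i => hAB (h _ ⟨i, rfl⟩)

theorem cl_inter_P {A : Set M.Carrier} (hA : A ⊆ M.P) : M.cl A ∩ M.P = A := by
  ext b
  constructor
  · rintro ⟨h, hb⟩
    exact (M.mem_cl_iff hA).1 h ⟨b, hb⟩ (by rw [M.base_coe ⟨b, hb⟩]; rfl)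
  · intro h
    exact ⟨Set.mem_sInter.2 fun B hB => hB.2 h, hA h⟩

/-- The base as a finite set. -/
noncomputable def baseFinset (b : M.Carrier) : Finset M.P := (Set.toFinite (M.base b)).toFinset

variable {M} {Λ : τ.Sym → Type u}

/-- The member of the space whose value at an element depends only on its base and its symbol. -/
noncomputable def ofBase (ξ : Finset M.P → (F : τ.Sym) → Λ F) : Space Λ M :=
  fun b => ξ (M.baseFinset b) (M.sym b)

theorem degreeLE_ofBase {C : Type*} (d : Space Λ M → C) :
    DegreeLE τ.arity fun ξ => d (ofBase ξ) := by
  intro ξ ξ' h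
  refine congrArg d (funext fun b => congrFun (h _ ?_ ?_) _)
  · simpa [baseFinset] using M.base_nonempty b
  · rw [baseFinset, ← Set.ncard_eq_toFinset_card]
    exact M.ncard_base_le b

/-- The closure of `S` consists of the elements whose base lies in `S`, which is exactly where
`lineUpdate` writes `p`. -/
theorem HasMonoLine.of_hasSetLine {C : Type*} {d : Space Λ M → C}
    (h : HasSetLine fun ξ => d (ofBase ξ)) : HasMonoLine d := by
  obtain ⟨S, hS, ξ, hξ⟩ := h
  have hP : Subtype.val '' (S : Set M.P) ⊆ M.P := by
    rintro _ ⟨x, -, rfl⟩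
    exact x.2
  have hmem : ∀ b, b ∈ M.cl (Subtype.val '' (S : Set M.P)) ↔ M.baseFinset b ⊆ S := by
    intro b
    rw [M.mem_cl_iff hP]
    simp [Finset.subset_iff, baseFinset]
  refine ⟨Set.range fun p => ofBase (lineUpdate S ξ p),
    ⟨M.cl (Subtype.val '' (S : Set M.P)), ?_, ?_, ?_, ?_, ?_⟩, ?_⟩
  · rw [M.cl_inter_P hP]
    exact (Finset.coe_nonempty.2 hS).image _
  · rw [M.cl_inter_P hP]
  · rintro _ ⟨p, rfl⟩ _ ⟨p', rfl⟩ b hb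
    rw [hmem] at hb
    simp [ofBase, lineUpdate, hb]
  · rintro _ ⟨p, rfl⟩
    refine ⟨p, Set.mem_univ _, fun b hb => ?_⟩
    rw [hmem] at hb
    simp [ofBase, lineUpdate, hb]
  · rintro p -
    refine ⟨_, ⟨p, rfl⟩, fun b hb => ?_⟩
    rw [hmem] at hb
    simp [ofBase, lineUpdate, hb]
  · rintro _ ⟨p, rfl⟩ _ ⟨p', rfl⟩
    exact hξ p p'

theorem card_types_le (Λ : τ.Sym → Type u) :
    Nat.card ((F : τ.Sym) → Λ F) ≤ alphabetMax Λ ^ τ.size := by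
  rw [Nat.card_pi]
  exact Finset.prod_le_pow_card _ _ _ fun F _ =>
    Finset.le_sup (f := fun F => Nat.card (Λ F)) (Finset.mem_univ F)

theorem hasMonoLine_of_lineBound_le [∀ F, Finite (Λ F)] [∀ F, Nonempty (Λ F)] {c : ℕ}
    (hM : lineBound τ.arity (alphabetMax Λ ^ τ.size) c ≤ M.dim) (d : Space Λ M → Fin c) :
    HasMonoLine d := by
  -- `ULift` moves the colours into the universe of the model, as `SetLineBound` requires.
  have h : HasSetLine fun ξ : Finset M.P → (F : τ.Sym) → Λ F => ULift.up.{u} (d (ofBase ξ)) :=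
    setLineBound_lineBound τ.arity (alphabetMax Λ ^ τ.size) c M.P ((F : τ.Sym) → Λ F)
      (ULift (Fin c)) _ (degreeLE_ofBase fun η => ULift.up (d η)) (card_types_le Λ) (by simp) hM
  obtain ⟨S, hS, ξ, hξ⟩ := h
  exact HasMonoLine.of_hasSetLine ⟨S, hS, ξ, fun p p' => ULift.up.inj (hξ p p')⟩

/-! ### Submodels and monotonicity in the dimension -/

variable (M)

/-- The submodel generated by a non-empty set of points. -/
noncomputable def restrict (Q : Set M.P) (hQ : Q.Nonempty) : Fim τ where
  Carrier := {b : M.Carrier // M.base b ⊆ Q}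
  finite_carrier := inferInstance
  P := {b | b.1 ∈ M.P}
  P_nonempty := by
    obtain ⟨x, hx⟩ := hQ
    exact ⟨⟨x, by simpa [base_coe] using hx⟩, x.2⟩
  order := LinearOrder.lift' (fun x => (⟨x.1.1, x.2⟩ : M.P)) fun x y h =>
    Subtype.ext (Subtype.ext (congrArg (fun z : M.P => z.1) h))
  fn F a := ⟨M.fn F fun i => ⟨(a i).1.1, (a i).2⟩, by
    rw [base_fn]
    rintro _ ⟨i, rfl⟩
    exact (a i).1.2 (by rw [M.base_coe ⟨(a i).1.1, (a i).2⟩]; rfl)⟩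
  fn_symm F σ a := Subtype.ext (M.fn_symm F σ fun i => ⟨(a i).1.1, (a i).2⟩)
  fn_inj F G a b ha hb h := by
    have h' := M.fn_inj F G _ _ (fun i j hij => ha hij) (fun i j hij => hb hij)
      (congrArg Subtype.val h)
    obtain rfl : F = G := congrArg Sigma.fst h'
    have h'' := eq_of_heq (Sigma.mk.inj h').2
    have : a = b := funext fun i =>
      Subtype.ext (Subtype.ext (congrArg (fun z : M.P => z.1) (congrFun h'' i)))
    rw [this]
  fn_surj b hb := by
    obtain ⟨F, a, h⟩ := M.fn_surj b.1 hb
    have hQ : ∀ i, M.base (a i) ⊆ Q := by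
      intro i
      rw [base_coe, Set.singleton_subset_iff]
      exact b.2 (by rw [← h, base_fn]; exact ⟨i, rfl⟩)
    exact ⟨F, fun i => ⟨⟨a i, hQ i⟩, (a i).2⟩, Subtype.ext h⟩
  fn_ident a i := Subtype.ext (M.fn_ident _ i)

variable {M} {Q : Set M.P} {hQ : Q.Nonempty}

theorem dim_restrict : (M.restrict Q hQ).dim = Q.ncard := by
  rw [← Nat.card_coe_set_eq]
  refine Nat.card_congr ⟨fun x => ⟨⟨x.1.1, x.2⟩, x.1.2 ?_⟩,
    fun x => ⟨⟨x.1, ?_⟩, x.1.2⟩, fun x => rfl, fun x => rfl⟩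
  · rw [M.base_coe ⟨x.1.1, x.2⟩]
    rfl
  · rw [base_coe, Set.singleton_subset_iff]
    exact x.2

/-- The inclusion of a submodel. -/
def restrictVal (b : (M.restrict Q hQ).Carrier) : M.Carrier := b.1

/-- Elements of a submodel from elements of the model. -/
def restrictMk (hQ : Q.Nonempty) (b : M.Carrier) (h : M.base b ⊆ Q) :
    (M.restrict Q hQ).Carrier := ⟨b, h⟩

theorem restrictVal_injective :
    Function.Injective (restrictVal : (M.restrict Q hQ).Carrier → M.Carrier) :=
  Subtype.val_injective

theorem base_restrictVal_subset (b : (M.restrict Q hQ).Carrier) : M.base (restrictVal b) ⊆ Q := b.2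

theorem sym_restrict (b : (M.restrict Q hQ).Carrier) :
    (M.restrict Q hQ).sym b = M.sym (restrictVal b) := by
  obtain ⟨F, a, rfl⟩ := (M.restrict Q hQ).exists_fn b
  rw [sym_fn]
  exact (M.sym_fn F _).symm

theorem forall_mem_base_restrict (b : (M.restrict Q hQ).Carrier)
    (X : Set (M.restrict Q hQ).Carrier) :
    (∀ x ∈ (M.restrict Q hQ).base b, (x : (M.restrict Q hQ).Carrier) ∈ X) ↔
      ∀ x ∈ M.base (restrictVal b), (x : M.Carrier) ∈ restrictVal '' X := by
  obtain ⟨F, a, rfl⟩ := (M.restrict Q hQ).exists_fn b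
  have : restrictVal ((M.restrict Q hQ).fn F a) =
      M.fn F fun i => ⟨restrictVal (a i).1, (a i).2⟩ := rfl
  rw [this, base_fn, base_fn, Set.forall_mem_range, Set.forall_mem_range]
  simp only [restrictVal_injective.mem_set_image]

theorem image_cl_restrict {X : Set (M.restrict Q hQ).Carrier} (hX : X ⊆ (M.restrict Q hQ).P) :
    restrictVal '' ((M.restrict Q hQ).cl X) = M.cl (restrictVal '' X) := by
  have hX' : restrictVal '' X ⊆ M.P := by
    rintro _ ⟨x, hx, rfl⟩
    exact hX hx
  ext b
  constructor
  · rintro ⟨b, hb, rfl⟩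
    rwa [mem_cl_iff _ hX', ← forall_mem_base_restrict, ← mem_cl_iff _ hX]
  · intro hb
    rw [mem_cl_iff _ hX'] at hb
    have hbQ : M.base b ⊆ Q := by
      intro x hx
      obtain ⟨y, hy, he⟩ := hb x hx
      refine base_restrictVal_subset y ?_
      rw [he, base_coe]
      rfl
    refine ⟨restrictMk hQ b hbQ, ?_, rfl⟩
    rw [mem_cl_iff _ hX, forall_mem_base_restrict]
    exact hb

open Classical in
/-- The extension of a member of the space over a submodel by fixed values. -/
noncomputable def extend [∀ F, Nonempty (Λ F)] (η : Space Λ (M.restrict Q hQ)) : Space Λ M :=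
  fun b => if h : M.base b ⊆ Q then
    cast (congrArg Λ (sym_restrict (restrictMk hQ b h))) (η (restrictMk hQ b h))
  else Classical.arbitrary _

theorem cast_apply_sym (p : (F : τ.Sym) → Λ F) {F G : τ.Sym} (h : F = G) :
    cast (congrArg Λ h) (p F) = p G := by
  subst h
  rfl

theorem extend_restrictVal [∀ F, Nonempty (Λ F)] {η : Space Λ (M.restrict Q hQ)}
    {p : (F : τ.Sym) → Λ F} {b : (M.restrict Q hQ).Carrier}
    (h : η b = p ((M.restrict Q hQ).sym b)) :
    extend η (restrictVal b) = p (M.sym (restrictVal b)) := by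
  rw [extend, dif_pos (base_restrictVal_subset b), ← cast_apply_sym p (sym_restrict b), ← h]
  rfl

/-- Extension by fixed values maps a line to a line with the same support, because closures in the
submodel and in the model coincide. -/
theorem HasMonoLine.of_restrict [∀ F, Nonempty (Λ F)] {C : Type*} {d : Space Λ M → C}
    (h : HasMonoLine fun η : Space Λ (M.restrict Q hQ) => d (extend η)) : HasMonoLine d := by
  obtain ⟨L, ⟨S, hne, hcl, hoff, htype, hall⟩, hmono⟩ := h
  have hP : restrictVal '' (S ∩ (M.restrict Q hQ).P) = restrictVal '' S ∩ M.P := by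
    ext b
    constructor
    · rintro ⟨b, ⟨hb, hbP⟩, rfl⟩
      exact ⟨⟨b, hb, rfl⟩, hbP⟩
    · rintro ⟨⟨b, hb, rfl⟩, hbP⟩
      exact ⟨b, ⟨hb, hbP⟩, rfl⟩
  refine ⟨extend '' L, ⟨restrictVal '' S, ?_, ?_, ?_, ?_, ?_⟩, ?_⟩
  · rw [← hP]
    exact hne.image _
  · rw [← hP, ← image_cl_restrict Set.inter_subset_right, ← hcl]
  · rintro _ ⟨η, hη, rfl⟩ _ ⟨ν, hν, rfl⟩ b hb
    by_cases hbQ : M.base b ⊆ Q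
    · have := hoff η hη ν hν (restrictMk hQ b hbQ) fun h => hb ⟨_, h, rfl⟩
      simp only [extend, dif_pos hbQ, this]
    · simp only [extend, dif_neg hbQ]
  · rintro _ ⟨η, hη, rfl⟩
    obtain ⟨p, hp, h⟩ := htype η hη
    refine ⟨p, hp, ?_⟩
    rintro _ ⟨b, hb, rfl⟩
    exact extend_restrictVal (h b hb)
  · intro p hp
    obtain ⟨η, hη, h⟩ := hall p hp
    refine ⟨_, ⟨η, hη, rfl⟩, ?_⟩
    rintro _ ⟨b, hb, rfl⟩
    exact extend_restrictVal (h b hb)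
  · rintro _ ⟨η, hη, rfl⟩ _ ⟨ν, hν, rfl⟩
    exact hmono η hη ν hν

end Fim

/-! ### The functions `f1` and `f0` -/

section Functions

variable {τ : Vocabulary.{u}} {Λ : τ.Sym → Type u} [∀ F, Nonempty (Λ F)]

/-- `F1Holds` concerns dimension exactly `k`; a larger model is restricted to `k` of its points.
This is needed because `f1` may lie below `lineBound`. -/
theorem F1Holds.hasMonoLine_of_le {c k : ℕ} (h : F1Holds Λ c k) (hk : 1 ≤ k) {M : Fim τ}
    (hM : k ≤ M.dim) (d : Fim.Space Λ M → Fin c) : Fim.HasMonoLine d := by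
  obtain ⟨Q, -, hQ⟩ := Set.exists_subset_card_eq (s := (Set.univ : Set M.P)) (n := k)
    (by rwa [Set.ncard_univ])
  have hne : Q.Nonempty := Set.nonempty_of_ncard_ne_zero (by omega)
  exact Fim.HasMonoLine.of_restrict (h (M.restrict Q hne) (Fim.dim_restrict.trans hQ) _)

theorem F1Holds.f0Holds {τ : Vocabulary.{u}} {Λ : τ.Sym → Type u} {c k : ℕ} (h : F1Holds Λ c k)
    (H : τ.Sym) (n ℓ : ℕ) : F0Holds Λ H n ℓ c k :=
  fun M hM d _ _ _ _ => h M hM d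

theorem f1Holds_lineBound [∀ F, Finite (Λ F)] (c : ℕ) :
    F1Holds Λ c (lineBound τ.arity (alphabetMax Λ ^ τ.size) c) :=
  fun _ hM d => Fim.hasMonoLine_of_lineBound_le hM.ge d

theorem f1_le_lineBound [∀ F, Finite (Λ F)] (c : ℕ) :
    f1 Λ c ≤ lineBound τ.arity (alphabetMax Λ ^ τ.size) c :=
  sInf_le ⟨_, one_le_lineBound _ _ _, f1Holds_lineBound c, rfl⟩

theorem f0_le_lineBound [∀ F, Finite (Λ F)] (H : τ.Sym) (n ℓ c : ℕ) :
    f0 Λ H n ℓ c ≤ lineBound τ.arity (alphabetMax Λ ^ τ.size) c :=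
  sInf_le ⟨_, one_le_lineBound _ _ _, (f1Holds_lineBound c).f0Holds H n ℓ, rfl⟩

theorem hasMonoLine_of_f1_le [∀ F, Finite (Λ F)] {c : ℕ} {M : Fim τ} (hM : f1 Λ c ≤ M.dim)
    (d : Fim.Space Λ M → Fin c) : Fim.HasMonoLine d := by
  -- The set is non-empty by the bound, so the infimum is attained.
  obtain ⟨k, hk, h, he⟩ : f1 Λ c ∈ {x : ℕ∞ | ∃ k : ℕ, 1 ≤ k ∧ F1Holds Λ c k ∧ x = k} :=
    csInf_mem ⟨_, _, one_le_lineBound _ _ _, f1Holds_lineBound c, rfl⟩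
  rw [he, Nat.cast_le] at hM
  exact h.hasMonoLine_of_le hk hM d

end Functions

theorem theorem2p5 :
    ((∀ (τ : Vocabulary.{u}) (Λ : τ.Sym → Type u) [∀ F, Finite (Λ F)] [∀ F, Nonempty (Λ F)] (c : ℕ),
        f1 Λ c ≠ ⊤ ∧
        ∀ M : Fim τ, f1 Λ c ≤ M.dim → ∀ d : Fim.Space Λ M → Fin c, Fim.HasMonoLine d) ∧
      ∃ B : (Fin 4 → ℕ) → ℕ, TripleRecursive B ∧
        ∀ (τ : Vocabulary.{u}) (Λ : τ.Sym → Type u) [∀ F, Finite (Λ F)] [∀ F, Nonempty (Λ F)] (c : ℕ),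
          f1 Λ c ≤ B ![τ.arity, τ.size, alphabetMax Λ, c]) ∧
    ((∀ (τ : Vocabulary.{u}) (Λ : τ.Sym → Type u) [∀ F, Finite (Λ F)] [∀ F, Nonempty (Λ F)]
        (H : τ.Sym) (n ℓ c : ℕ), τ.IsMaxSym H →
        (n < Nat.card (Λ H) ∨ (n = Nat.card (Λ H) ∧ ℓ = 0)) → f0 Λ H n ℓ c ≠ ⊤) ∧
      ∃ B : (Fin 6 → ℕ) → ℕ, TripleRecursive B ∧
        ∀ (τ : Vocabulary.{u}) (Λ : τ.Sym → Type u) [∀ F, Finite (Λ F)] [∀ F, Nonempty (Λ F)]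
          (H : τ.Sym) (n ℓ c : ℕ), τ.IsMaxSym H →
          (n < Nat.card (Λ H) ∨ (n = Nat.card (Λ H) ∧ ℓ = 0)) →
          f0 Λ H n ℓ c ≤ B ![τ.arity, τ.size, alphabetMax Λ, n, ℓ, c]) := by
  refine ⟨⟨fun τ Λ _ _ c => ⟨ne_top_of_le_ne_top (ENat.natCast_ne_top _) (f1_le_lineBound c),
      fun M hM d => hasMonoLine_of_f1_le hM d⟩, _, tripleRecursive_lineBound 0 1 2 3,
      fun τ Λ _ _ c => f1_le_lineBound c⟩,
    fun τ Λ _ _ H n ℓ c _ _ => ne_top_of_le_ne_top (ENat.natCast_ne_top _) (f0_le_lineBound H n ℓ c),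
    _, tripleRecursive_lineBound 0 1 2 5, fun τ Λ _ _ H n ℓ c _ _ => f0_le_lineBound H n ℓ c⟩
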